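/- **Setting.** Let $n\in\{2,3\}$ and let $Y\subset\mathbb R^n$ be a domain with $\partial Y=\partial_\sigma Y\sqcup\partial_u Y$. A mixed-dimensional geometry in $Y$ consists of finitely many mutually disjoint, nonempty, flat manifolds $\Omega_i\subseteq Y$, $i\in I$, each relatively open in an affine subspace of dimension $d_i\le n$. The manifolds with $d_i=n$ form the surrounding medium, $\bigcup_{d_i=n}\Omega_i=\operatorname{int}(Y\setminus\bigcup_{d_i<n}\Omega_i)$, and within $Y$ the closures of two different $d$-manifolds, $d<n$, meet only in closures of manifolds of lower dimension. For each $i$ let $\hat J_i$ index the interfaces $\Gamma_j$, $j\in\hat J_i$: each $\Gamma_j$ coincides with $\Omega_i$ and is one side of $\Omega_i$ on which a manifold $\Omega_{\hat\jmath}$ with $d_{\hat\jmath}=d_i+1$ borders, so that $\Gamma_j\subseteq\partial\Omega_{\hat\jmath}$; $\boldsymbol n$ is the unit normal on $\Gamma_j$, tangent to and outward with respect to $\Omega_{\hat\jmath}$. (One $\Omega_{\hat\jmath}$ may border on both sides; then there are two indices.) Every such side has exactly one index, and $\hat J_i\neq\emptyset$ if $d_i<n$. Let $\check J_i$ be the set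 of all $j$ with $\hat\jmath=i$, let $\partial_u\Omega_i=\partial_uY\cap\partial\Omega_i$ and $\partial_\sigma\Omega_i=\partial\Omega_i\setminus(\bigcup_{j\in\check J_i}\Gamma_j\cup\partial_u\Omega_i)$, and assume that $\partial_u\Omega_i$ has positive $(n-1)$-dimensional measure if $d_i=n$. **Scaling.** Let $\epsilon_i>0$ ($i\in I$, with $\epsilon_i=1$ if $d_i=n$) and $\gamma_j>0$ be constants. Put $\hat\epsilon_{\max,i}=\max_{j\in\hat J_i}\epsilon_{\hat\jmath}$ if $d_i<n$, and $\hat\epsilon_{\max,i}=1$ if $d_i=n$. Assume that for a constant $K$ $$K^{-1}\gamma_j^{\,n-d_i}\le\epsilon_i^2\le K\gamma_j^{\,n-d_i}\ (j\in\hat J_i),\qquad \epsilon_i\le K\hat\epsilon_{\max,i},\qquad \epsilon_i\le K .$$ **Spaces and forms.** $\boldsymbol U=\prod_{i}L^2(\Omega_i)^n$, $R=\prod_{d_i\ge2}L^2(\Omega_i)^{d_i(d_i-1)/2}$, and $\Sigma$ is the set of $\sigma=(\sigma_i)_{d_i\ge1}$, $\sigma_i:\Omega_i\to\mathbb R^{n\times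 d_i}$, with rows in $H(\operatorname{div},\Omega_i)$, with $\boldsymbol n\cdot\sigma_i=0$ on $\partial_\sigma\Omega_i$ and $\boldsymbol n\cdot\sigma_i|_{\Gamma_j}\in L^2(\Gamma_j)^n$ for $j\in\check J_i$ (normal traces in the sense of Green's formula, with no condition on $\partial_u\Omega_i$). The mixed-dimensional divergence is $$(\mathfrak D\cdot\epsilon\sigma)_i=\epsilon_i\nabla\cdot\sigma_i-\sum_{j\in\hat J_i}\epsilon_{\hat\jmath}\,(\boldsymbol n\cdot\sigma_{\hat\jmath})|_{\Gamma_j},$$ without the first term if $d_i=0$, and $\operatorname{skw}$ is the vector of asymmetries of the in-plane part of a tensor: $b_{12}-b_{21}$ if $d_i=2$, and $(b_{23}-b_{32},\,b_{31}-b_{13},\,b_{12}-b_{21})$ if $d_i=3$. All inner products and norms on $\Omega$ and on $\Gamma$ are sums of $L^2$ inner products over all $\Omega_i$ and all $\Gamma_j$, and $$(\sigma,\tau)_{\Omega\times\Gamma}=(\sigma,\tau)_\Omega+(\boldsymbol n\cdot\sigma,\boldsymbol n\cdot\tau)_\Gamma .$$ Let $\mathcal A$ be a linear constitutive operator on $L^2$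 fields on $\Omega\times\Gamma$ (tensor fields on $\Omega$ together with vector fields on $\Gamma$) and let $\mathfrak A=\epsilon\mathcal A\epsilon^{-1}$, where on $\Gamma_j$ the factor $\epsilon$ is $\epsilon_{\hat\jmath}$. It is assumed that $\mathfrak A$ is continuous and coercive on $\Sigma$, with constants $\alpha>0$ and $\beta$ that do not depend on $\epsilon$: for all $\sigma,\tau\in\Sigma$, $$(\mathfrak A\sigma,\tau)_{\Omega\times\Gamma}\le\beta\|\sigma\|_{\Omega\times\Gamma}\|\tau\|_{\Omega\times\Gamma},\qquad(\mathfrak A\sigma,\sigma)_{\Omega\times\Gamma}\ge\alpha\|\sigma\|_{\Omega\times\Gamma}^2 .$$ Define $$a(\sigma;\tau)=(\mathfrak A\sigma,\tau)_{\Omega\times\Gamma},\qquad b(\sigma;\boldsymbol v,s)=(\mathfrak D\cdot\epsilon\sigma,\boldsymbol v)_\Omega+(\operatorname{skw}\epsilon\sigma,s)_\Omega,$$ $$\|\sigma\|_\Sigma^2=\|\sigma\|_\Omega^2+\|\boldsymbol n\cdot\sigma\|_\Gamma^2+\|\hat\epsilon_{\max}^{-1}\,\mathfrak D\cdot\epsilon\sigma\|_\Omega^2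 .$$ **Theorem (Ellipticity).** Given the geometry and the constants $K,\alpha,\beta$, there is a constant $C>0$, independent of $\epsilon$, $\gamma$ and $\mathcal A$, such that for all $\epsilon,\gamma,\mathcal A$ as above and every $\sigma\in\Sigma$ with $$b(\sigma;\boldsymbol v,s)=0\qquad\text{for all }(\boldsymbol v,s)\in\boldsymbol U\times R,$$ one has $a(\sigma;\sigma)\ge C\,\|\sigma\|_\Sigma^2$. -/

import Mathlib

open MeasureTheory Filter Topology
open scoped ContDiff

noncomputable section

/-- Euclidean space `ℝⁿ`. -/
abbrev Euc (n : ℕ) := EuclideanSpace ℝ (Fin n)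

/-- `n × d` matrices with the Frobenius inner product; the entry `b_{kc}` of `B` is `B (k, c)`. -/
abbrev EucMat (n d : ℕ) := EuclideanSpace ℝ (Fin n × Fin d)

/-- `Ω = χ(D)` is a flat manifold, `Ω' = χ'(D')` another one, and `ν` is a unit vector of the tangent
space of `Ω'`.  `IsSide χ D χ' D' ν` says that all of `Ω` is a flat piece of the boundary of `Ω'`
(relative to the affine hull of `Ω'`), that `ν` is normal to `Ω`, and that `Ω'` borders on `Ω` from
the side to which `-ν` points, so that `ν` is outward with respect to `Ω'` on this side of `Ω`.
`Ω'` may also border on the opposite side of `Ω`; then `IsSide` holds for `-ν` as well. -/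
def IsSide {p q n : ℕ} (χ : Euc p →ᵃⁱ[ℝ] Euc n) (D : Set (Euc p))
    (χ' : Euc q →ᵃⁱ[ℝ] Euc n) (D' : Set (Euc q)) (ν : Euc n) : Prop :=
  ‖ν‖ = 1 ∧ (∃ w : Euc q, χ'.linearIsometry w = ν) ∧
  (∀ w : Euc p, inner ℝ ν (χ.linearIsometry w) = 0) ∧
  χ '' D ⊆ closure (χ' '' D') \ (χ' '' D') ∧
  ∀ y ∈ D, ∃ r > 0, ∀ z : Euc q,
    dist (χ' z) (χ y) < r → inner ℝ (χ' z - χ y) ν < 0 → z ∈ D'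

/-- A mixed-dimensional geometry in an `n`-dimensional domain `Y`. -/
structure MixedDimGeometry (n : ℕ) where
  /-- the surrounding domain -/
  Y : Set (Euc n)
  isOpen_Y : IsOpen Y
  isConnected_Y : IsConnected Y
  /-- the part `∂_u Y` of the boundary on which the displacement is prescribed; the rest of the
  boundary is `∂_σ Y` -/
  duY : Set (Euc n)
  duY_subset : duY ⊆ frontier Y
  /-- the indices of the manifolds `Ω_i` -/
  I : Type
  [fintypeI : Fintype I]
  [decidableEqI : DecidableEq I]
  /-- the dimension `d_i` -/
  dim : I → ℕ
  /-- orthonormal affine coordinates on the affine hull of `Ω_i` (the manifolds are flat) -/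
  chart : ∀ i, Euc (dim i) →ᵃⁱ[ℝ] Euc n
  /-- `Ω_i` in these coordinates -/
  dom : ∀ i, Set (Euc (dim i))
  isOpen_dom : ∀ i, IsOpen (dom i)
  nonempty_dom : ∀ i, (dom i).Nonempty
  subset_Y : ∀ i, chart i '' dom i ⊆ Y
  disjoint : ∀ i i', i ≠ i' → Disjoint (chart i '' dom i) (chart i' '' dom i')
  /-- the manifolds of full dimension form the surrounding medium -/
  medium : (⋃ i ∈ {i | dim i = n}, chart i '' dom i)
    = interior (Y \ ⋃ i ∈ {i | dim i < n}, chart i '' dom i)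
  /-- intersections of `d`-manifolds consist of manifolds of lower dimension -/
  intersections : ∀ i i', i ≠ i' → dim i = dim i' → dim i < n →
    closure (chart i '' dom i) ∩ closure (chart i' '' dom i') ∩ Y
      ⊆ ⋃ k ∈ {k | dim k < dim i}, closure (chart k '' dom k)
  /-- `J i` is the set of the interfaces `Γ_j` that coincide with `Ω_i`, one for each side of `Ω_i`
  on which a manifold of dimension `d_i + 1` borders -/
  J : I → Type
  [fintypeJ : ∀ i, Fintype (J i)]
  /-- the manifold whose boundary contains `Γ_j` -/
  hi : ∀ {i}, J i → I
  dim_hi : ∀ {i} (j : J i), dim (hi j) = dim i + 1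
  /-- the unit normal on `Γ_j`, outward with respect to the manifold `hi j` -/
  normal : ∀ {i}, J i → Euc n
  isSide : ∀ {i} (j : J i), IsSide (chart i) (dom i) (chart (hi j)) (dom (hi j)) (normal j)
  /-- each side has only one index -/
  side_unique : ∀ {i} (j j' : J i), hi j = hi j' → normal j = normal j' → j = j'
  /-- each side has an index -/
  side_exists : ∀ i k ν, dim k = dim i + 1 → IsSide (chart i) (dom i) (chart k) (dom k) ν →
    ∃ j : J i, hi j = k ∧ normal j = ν
  /-- only structures of codimension one in a manifold of the geometry are embedded -/
  adjacent : ∀ i, dim i < n → Nonempty (J i)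
  /-- `|∂_u Ω_i| > 0` for the manifolds of full dimension -/
  duY_pos : ∀ i, dim i = n → 0 < Measure.hausdorffMeasure ((n : ℝ) - 1)
    (duY ∩ (closure (chart i '' dom i) \ chart i '' dom i))

attribute [instance] MixedDimGeometry.fintypeI MixedDimGeometry.decidableEqI
  MixedDimGeometry.fintypeJ

/-- `skw` of a `2 × 2` matrix. -/
def skw2 : (Fin 2 → Fin 2 → ℝ) →ₗ[ℝ] EuclideanSpace ℝ (Fin 1) where
  toFun B := !₂[B 0 1 - B 1 0]
  map_add' B C := by ext k; fin_cases k; simp; ring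
  map_smul' c B := by ext k; fin_cases k; simp; ring

/-- `skw` of a `3 × 3` matrix. -/
def skw3 : (Fin 3 → Fin 3 → ℝ) →ₗ[ℝ] EuclideanSpace ℝ (Fin 3) where
  toFun B := !₂[B 1 2 - B 2 1, B 2 0 - B 0 2, B 0 1 - B 1 0]
  map_add' B C := by ext k; fin_cases k <;> simp <;> ring
  map_smul' c B := by ext k; fin_cases k <;> simp <;> ring

/-- The operator `skw` on the in-plane `d × d` part of a tensor, for `d = 2, 3`, as a linear map.  For
`d = 0, 1` its target is the zero space. -/
def skw : (d : ℕ) → (Fin d → Fin d → ℝ) →ₗ[ℝ] EuclideanSpace ℝ (Fin (d.choose 2))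
  | 2 => skw2
  | 3 => skw3
  | _ => 0

namespace MixedDimGeometry

variable {n : ℕ} (G : MixedDimGeometry n)

/-- The manifold `Ω_i`. -/
def Omega (i : G.I) : Set (Euc n) := G.chart i '' G.dom i

/-- `∂_u Ω_i = ∂_u Y ∩ ∂Ω_i`, with the boundary relative to the affine hull of `Ω_i`. -/
def duOmega (i : G.I) : Set (Euc n) := G.duY ∩ (closure (G.Omega i) \ G.Omega i)

/-- Lebesgue measure on `Ω_i`, and on each `Γ_j`, `j ∈ J i`, in the coordinates of `Ω_i`.
For `d_i = 0` it is the unit mass. -/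
def vol (i : G.I) : Measure (Euc (G.dim i)) := volume.restrict (G.dom i)

/-- `L²(Ω_i)^n`.  It is also `L²(Γ_j)^n` for `j ∈ J i`. -/
abbrev VecL2 (i : G.I) := Lp (Euc n) 2 (G.vol i)

/-- `L²(Ω_i)^{n × d_i}`, the zero space for `d_i = 0`.  The columns refer to the coordinates of
`Ω_i`, the rows to the standard basis of `ℝⁿ`. -/
abbrev MatL2 (i : G.I) := Lp (EucMat n (G.dim i)) 2 (G.vol i)

/-- `L²(Ω_i)^{k_d}` with `k_d = d (d - 1) / 2`, `d = d_i`; the zero space for `d_i = 0, 1`. -/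
abbrev SkwL2 (i : G.I) := Lp (EuclideanSpace ℝ (Fin ((G.dim i).choose 2))) 2 (G.vol i)

/-- Tensor fields on `Ω` together with vector fields on `Γ`, all of class `L²`. -/
abbrev FieldL2 := (∀ i, G.MatL2 i) × (∀ i, G.J i → G.VecL2 i)

/-- The displacement space `U`. -/
abbrev U := ∀ i, G.VecL2 i

/-- The multiplier space `R`. -/
abbrev R := ∀ i, G.SkwL2 i

/-- The derivative of `v : Ω_i → ℝ` along the `c`-th tangential coordinate. -/
def partialDeriv (i : G.I) (v : Euc n → ℝ) (c : Fin (G.dim i)) (x : Euc (G.dim i)) : ℝ :=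
  fderiv ℝ (v ∘ G.chart i) x (EuclideanSpace.single c 1)

/-- The row-wise divergence of `τ` in the distributional sense on `Ω_i` is `q`. -/
def HasWeakDiv (i : G.I) (τ : G.MatL2 i) (q : G.VecL2 i) : Prop :=
  ∀ v : Euc n → ℝ, ContDiff ℝ ∞ (v ∘ G.chart i) → HasCompactSupport (v ∘ G.chart i) →
    tsupport (v ∘ G.chart i) ⊆ G.dom i →
    ∀ k : Fin n, ∫ x, (∑ c, τ x (k, c) * G.partialDeriv i v c x) ∂(G.vol i)
      = - ∫ x, q x k * v (G.chart i x) ∂(G.vol i)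

/-- Test functions on `Ω_i` that vanish near `∂_u Ω_i`: smooth in `Ω_i`, bounded with bounded
gradient, of bounded support.  They need not be continuous across a manifold of lower dimension
around which `Ω_i` lies on both sides. -/
def IsTest (i : G.I) (v : Euc n → ℝ) : Prop :=
  ContDiffOn ℝ ∞ (v ∘ G.chart i) (G.dom i) ∧
  (∃ M : ℝ, ∀ x ∈ G.dom i, |v (G.chart i x)| ≤ M ∧ ‖fderiv ℝ (v ∘ G.chart i) x‖ ≤ M) ∧
  (∃ r : ℝ, ∀ x ∈ G.dom i, r < ‖x‖ → v (G.chart i x) = 0) ∧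
  ∃ W : Set (Euc n), IsOpen W ∧ G.duOmega i ⊆ W ∧ ∀ x ∈ W ∩ G.Omega i, v x = 0

/-- `w` is the trace on `Γ_j` of the function `v` on `Ω_{hi j}`, taken from the side of `Γ_j` on
which `Ω_{hi j}` lies. -/
def IsTrace {i : G.I} (j : G.J i) (v : Euc n → ℝ) (w : Euc (G.dim i) → ℝ) : Prop :=
  ∀ y ∈ G.dom i,
    Tendsto (fun t : ℝ => v (G.chart i y - t • G.normal j)) (𝓝[>] 0) (𝓝 (w y))

/-- For `τ` on `Ω_k` with row-wise divergence `q`: the normal trace `n · τ` on `Γ_j` is the `L²` field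
`g_j` for each `Γ_j` in the boundary of `Ω_k`, and it vanishes on
`∂_σ Ω_k = ∂Ω_k \ (⋃_j Γ_j ∪ ∂_u Ω_k)`.  As usual in `H(div)`, normal traces are defined by Green's
formula `∫_{Ω_k} τ · ∇v + (∇ · τ) v = ∫_{∂Ω_k} (n · τ) v`; there is no condition on `∂_u Ω_k` because
the test functions vanish there. -/
def HasNormalTraces (k : G.I) (τ : G.MatL2 k) (q : G.VecL2 k)
    (g : ∀ i, G.J i → G.VecL2 i) : Prop :=
  ∀ v : Euc n → ℝ, G.IsTest k v →
  ∀ w : (∀ i, G.J i → Euc (G.dim i) → ℝ), (∀ i (j : G.J i), G.hi j = k → G.IsTrace j v (w i j)) →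
  ∀ a : Fin n,
    ∫ x, ((∑ c, τ x (a, c) * G.partialDeriv k v c x) + q x a * v (G.chart k x)) ∂(G.vol k)
      = ∑ i, ∑ j : G.J i, if G.hi j = k then ∫ y, g i j y a * w i j y ∂(G.vol i) else 0

/-- The stress space `Σ`.  An element is a field `σ` in `L²` with rows in `H(div, Ω_i)` for each `i`,
with zero normal trace on `∂_σ Ω_i` and with normal traces in `L²` on the interfaces.  The divergence
and the normal traces, which `σ` determines, are recorded with it. -/
structure StressSpace where
  /-- the field `σ` -/
  val : ∀ i, G.MatL2 i
  /-- the divergence `∇ · σ_i` within `Ω_i` -/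
  div : ∀ i, G.VecL2 i
  /-- the normal trace `n · σ_{hi j}` on `Γ_j`, `j ∈ J i` -/
  trace : ∀ i, G.J i → G.VecL2 i
  hasWeakDiv : ∀ i, G.HasWeakDiv i (val i) (div i)
  hasNormalTraces : ∀ i, G.HasNormalTraces i (val i) (div i) trace

/-- The inner product of `L²` fields on `Ω × Γ`. -/
def innerOG (f h : G.FieldL2) : ℝ :=
  ∑ i, inner ℝ (f.1 i) (h.1 i) + ∑ i, ∑ j, inner ℝ (f.2 i j) (h.2 i j)

variable {G}

/-- `σ ∈ Σ` as a field on `Ω × Γ`, that is, the pair `(σ, n · σ)`. -/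
def StressSpace.toField (σ : G.StressSpace) : G.FieldL2 := (σ.val, σ.trace)

/-- `‖σ‖_{Ω × Γ}`. -/
def StressSpace.normOG (σ : G.StressSpace) : ℝ := √(G.innerOG σ.toField σ.toField)

variable (G)

/-- The scaling parameters: `ε` constant on each `Ω_i`, `γ` constant on each `Γ_j`. -/
structure Scaling where
  eps : G.I → ℝ
  gam : ∀ i, G.J i → ℝ
  eps_pos : ∀ i, 0 < eps i
  gam_pos : ∀ i j, 0 < gam i j
  eps_top : ∀ i, G.dim i = n → eps i = 1

variable {G}

namespace Scaling

variable (S : G.Scaling)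

/-- `ε̂_max` on `Ω_i`: the maximum over `j ∈ J i` (a finite nonempty set if `d_i < n`) of the value of
`ε` on the adjacent manifold `Ω_{hi j}`; unity in `Ω^n`. -/
def epsMax (i : G.I) : ℝ := if G.dim i = n then 1 else ⨆ j : G.J i, S.eps (G.hi j)

/-- The relations `ε_i² ≂ γ_j^{n - d_i}`, `ε ≲ ε̂_max` and `ε ≲ 1`, with the constant `K`. -/
def Admissible (K : ℝ) : Prop :=
  (∀ i (j : G.J i), S.eps i ^ 2 ≤ K * S.gam i j ^ (n - G.dim i) ∧
    S.gam i j ^ (n - G.dim i) ≤ K * S.eps i ^ 2) ∧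
  (∀ i, S.eps i ≤ K * S.epsMax i) ∧ ∀ i, S.eps i ≤ K

end Scaling

variable (G)

/-- Multiplication of a field on `Ω × Γ` by a factor that is constant on each `Ω_i`; on `Γ_j` the value
on the higher-dimensional manifold `Ω_{hi j}` is used. -/
def scaleField (e : G.I → ℝ) : G.FieldL2 →ₗ[ℝ] G.FieldL2 where
  toFun f := (fun i => e i • f.1 i, fun i j => e (G.hi j) • f.2 i j)
  map_add' f h := by
    refine Prod.ext ?_ ?_
    · funext i; exact smul_add _ _ _
    · funext i j; exact smul_add _ _ _
  map_smul' c f := by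
    refine Prod.ext ?_ ?_
    · funext i; exact smul_comm (e i) c (f.1 i)
    · funext i j; exact smul_comm (e (G.hi j)) c (f.2 i j)

variable {G}

/-- `𝔄 = ε 𝒜 ε⁻¹`, where `𝒜` is the constitutive operator acting on the averaged stress. -/
def Scaling.frakA (S : G.Scaling) (A : G.FieldL2 →ₗ[ℝ] G.FieldL2) :
    G.FieldL2 →ₗ[ℝ] G.FieldL2 :=
  G.scaleField S.eps ∘ₗ A ∘ₗ G.scaleField (fun i => (S.eps i)⁻¹)

/-- `a(σ; τ) = (𝔄 σ, τ)_{Ω × Γ}`. -/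
def formA (A : G.FieldL2 →ₗ[ℝ] G.FieldL2) (σ τ : G.StressSpace) : ℝ :=
  G.innerOG (A σ.toField) τ.toField

/-- `𝔄` is continuous and coercive on `Σ` with respect to `‖·‖_{Ω × Γ}`, with constants `β` and `α`. -/
def IsContinuousCoercive (A : G.FieldL2 →ₗ[ℝ] G.FieldL2) (α β : ℝ) : Prop :=
  (∀ σ τ : G.StressSpace, formA A σ τ ≤ β * (σ.normOG * τ.normOG)) ∧
  ∀ σ : G.StressSpace, α * σ.normOG ^ 2 ≤ formA A σ σ

variable (G)

/-- `skw` of the in-plane components `t_a · (B e_c)` of an `n × d_i` tensor `B` on `Ω_i`, where the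
`t_a` are the orthonormal tangent vectors of the coordinates of `Ω_i`. -/
def skwLocal (i : G.I) :
    EucMat n (G.dim i) →L[ℝ] EuclideanSpace ℝ (Fin ((G.dim i).choose 2)) :=
  LinearMap.toContinuousLinearMap
    { toFun := fun B => skw (G.dim i) fun a c =>
        ∑ k, (G.chart i).linearIsometry (EuclideanSpace.single a 1) k * B (k, c)
      map_add' := fun B C => by
        rw [← map_add]; congr 1; funext a c
        simp [mul_add, Finset.sum_add_distrib]
      map_smul' := fun r B => by
        rw [RingHom.id_apply, ← map_smul]; congr 1; funext a c
        simp [Finset.mul_sum, mul_left_comm] }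

variable {G}

namespace Scaling

variable (S : G.Scaling)

/-- The mixed-dimensional divergence `𝔇 · εσ = ∇ · εσ - ⟦n · ε̂σ̂⟧`. -/
def mdDiv (σ : G.StressSpace) : G.U :=
  fun i => S.eps i • σ.div i - ∑ j : G.J i, S.eps (G.hi j) • σ.trace i j

/-- `skw εσ`. -/
def skwStress (σ : G.StressSpace) : G.R :=
  fun i => (G.skwLocal i).compLp (S.eps i • σ.val i)

/-- `b(σ; v, s) = (𝔇 · εσ, v)_Ω + (skw εσ, s)_Ω`. -/
def formB (σ : G.StressSpace) (v : G.U) (s : G.R) : ℝ :=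
  ∑ i, inner ℝ (S.mdDiv σ i) (v i) + ∑ i, inner ℝ (S.skwStress σ i) (s i)

/-- `‖σ‖_Σ = (‖σ‖_Ω² + ‖n · σ‖_Γ² + ‖ε̂_max⁻¹ 𝔇 · εσ‖_Ω²)^{1/2}`. -/
def normSigma (σ : G.StressSpace) : ℝ :=
  √(∑ i, ‖σ.val i‖ ^ 2 + ∑ i, ∑ j, ‖σ.trace i j‖ ^ 2
    + ∑ i, ‖(S.epsMax i)⁻¹ • S.mdDiv σ i‖ ^ 2)

end Scaling

end MixedDimGeometry

end

namespace MixedDimGeometry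

variable {n : ℕ} {G : MixedDimGeometry n}

/-! The norm on `Σ` exceeds the norm on `Ω × Γ`, in which coercivity is assumed, only by the
weighted term in `𝔇 · εσ`, and this term vanishes on the kernel of `b`. Indeed, divergences and
normal traces of elements of `Σ` are `L²` fields, so `𝔇 · εσ` itself belongs to `U` and may be used
as test function: `b(σ; 𝔇 · εσ, 0) = ‖𝔇 · εσ‖²`. Hence the kernel consists of fields with `𝔇 · εσ =
0` (`mdDiv_eq_zero`), the two norms agree there (`normSigma_eq_normOG`), and coercivity of `𝔄`
carries over with the same constant `α`. Symmetry of the stress, the other condition encoded in the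
kernel, plays no role. -/

theorem innerOG_self (f : G.FieldL2) :
    G.innerOG f f = ∑ i, ‖f.1 i‖ ^ 2 + ∑ i, ∑ j, ‖f.2 i j‖ ^ 2 := by
  simp only [innerOG, real_inner_self_eq_norm_sq]


namespace Scaling

variable (S : G.Scaling)

/-- The choice `s = 0` removes the asymmetry term, so that only the divergence is tested, against
itself. -/
theorem formB_mdDiv_zero (σ : G.StressSpace) :
    S.formB σ (S.mdDiv σ) 0 = ∑ i, ‖S.mdDiv σ i‖ ^ 2 := by
  simp only [formB, real_inner_self_eq_norm_sq, Pi.zero_apply, inner_zero_right,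
    Finset.sum_const_zero, add_zero]

/-- The elements of the kernel of `b` are divergence free in the mixed-dimensional sense. -/
theorem mdDiv_eq_zero {σ : G.StressSpace} (h : ∀ (v : G.U) (s : G.R), S.formB σ v s = 0) (i : G.I) :
    S.mdDiv σ i = 0 := by
  -- Unification fills in the test pair `(𝔇 · εσ, 0)`. The resulting sum of squares is zero, so each
  -- manifold contributes zero separately.
  have hsum := (S.formB_mdDiv_zero σ).symm.trans (h _ _)
  rw [Finset.sum_eq_zero_iff_of_nonneg fun _ _ => by positivity] at hsum
  simpa using hsum i (Finset.mem_univ i)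

/-- The factor `ε̂_max⁻¹` multiplies a zero field, so its size is irrelevant and the equality is
exact, uniformly in the scaling. -/
theorem normSigma_eq_normOG {σ : G.StressSpace} (h : ∀ i, S.mdDiv σ i = 0) :
    S.normSigma σ = σ.normOG := by
  simp only [normSigma, StressSpace.normOG, innerOG_self, h, smul_zero, norm_zero, ne_eq,
    OfNat.ofNat_ne_zero, not_false_eq_true, zero_pow, Finset.sum_const_zero, add_zero]
  -- What remains differs only by the projections of the pair `σ.toField = (σ.val, σ.trace)`.
  rfl

end Scaling

end MixedDimGeometry

theorem mainTheorem9 (n : ℕ) (hn : n = 2 ∨ n = 3) (G : MixedDimGeometry n)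
    (K α β : ℝ) (hα : 0 < α) :
    ∃ C : ℝ, 0 < C ∧
      ∀ S : G.Scaling, S.Admissible K →
      ∀ A : G.FieldL2 →ₗ[ℝ] G.FieldL2,
        MixedDimGeometry.IsContinuousCoercive (S.frakA A) α β →
      ∀ σ : G.StressSpace,
        (∀ (v : G.U) (s : G.R), S.formB σ v s = 0) →
        C * S.normSigma σ ^ 2 ≤ MixedDimGeometry.formA (S.frakA A) σ σ := by
  -- Since the norms coincide on the kernel, the coercivity constant itself serves as `C`; it is
  -- fixed before `ε`, `γ` and `𝒜`.
  refine ⟨α, hα, fun S _ A hA σ hσ => ?_⟩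
  rw [S.normSigma_eq_normOG (S.mdDiv_eq_zero hσ)]
  exact hA.2 σ
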